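/- Let $\mathcal X$ be a complex Banach space, let $\mathbb J$ be $\mathbb N=\{1,2,\dots\}$ or $\mathbb Z$, and let $\{P_k : k\in\mathbb J\}$ be a disjunctive resolution of the identity in $\mathcal X$: the $P_k$ are bounded idempotents with $P_iP_j=0$ for $i\neq j$, the series $\sum_{k\in\mathbb J}P_kx$ converges unconditionally to $x$ for every $x\in\mathcal X$, and $P_kx=0$ for all $k\in\mathbb J$ implies $x=0$. Let $T(t)x=\sum_{k\in\mathbb J}e^{ikt}P_kx$, $t\in\mathbb R$, be the corresponding strongly continuous bounded representation of $\mathbb R$ in $\mathcal X$, and let $A:D(A)\subset\mathcal X\to\mathcal X$ be the generator of the associated $L_1(\mathbb R)$-module, that is, the closed linear operator such that every $z\in\mathbb C\setminus\mathbb R$ belongs to its resolvent set and $$(A-zI)^{-1}x=\int_{\mathbb R}f_z(t)\,T(-t)x\,dt,\qquad x\in\mathcal X,$$ where $f_z\in L_1(\mathbb R)$ is the function with $\int_{\mathbb R}f_z(t)e^{-i\lambda t}\,dt=(\lambda-z)^{-1}$ for all $\lambda\in\mathbb R$. Let $B$ be a bounded linear operator on $\mathcal X$ whose matrix $(P_iBP_j)_{i,j\in\mathbb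 J}$ is strictly upper triangular ($P_iBP_j=0$ whenever $i\ge j$) or strictly lower triangular ($P_iBP_j=0$ whenever $i\le j$). Then the operator $A-B$, with domain $D(A)$, is similar to $A$: there is a bounded linear operator $U$ on $\mathcal X$ with a bounded inverse such that $U D(A)=D(A)$ and $(A-B)Ux=UAx$ for all $x\in D(A)$. -/

import Mathlib

noncomputable section

namespace SimilarOperators

open Filter Topology MeasureTheory

variable {X : Type*} [NormedAddCommGroup X] [NormedSpace ℂ X]

/-- A (disjunctive) resolution of the identity in `X`, indexed by a set `J` of integers: bounded
idempotents `P k` with `P i P j = 0` for `i ≠ j`, such that for every `x` the series `∑ P k x`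
converges unconditionally to `x`, and only `x = 0` is annihilated by all of the `P k`. -/
structure IsResolutionOfIdentity {J : Set ℤ} (P : J → X →L[ℂ] X) : Prop where
  idempotent : ∀ k, P k ∘L P k = P k
  disjoint : ∀ i j, i ≠ j → P i ∘L P j = 0
  hasSum : ∀ x, HasSum (fun k => P k x) x
  eq_zero : ∀ x, (∀ k, P k x = 0) → x = 0

/-- The matrix of a bounded operator `B` with respect to a resolution of the identity:
the operator matrix with entries `P i B P j`. -/
def operatorMatrix {J : Set ℤ} (P : J → X →L[ℂ] X) (B : X →L[ℂ] X) (i j : J) : X →L[ℂ] X :=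
  P i ∘L B ∘L P j

/-- All entries on and below the main diagonal vanish. -/
def IsStrictlyUpperTriangular {J : Set ℤ} (M : J → J → X →L[ℂ] X) : Prop :=
  ∀ i j : J, j ≤ i → M i j = 0

/-- All entries on and above the main diagonal vanish. -/
def IsStrictlyLowerTriangular {J : Set ℤ} (M : J → J → X →L[ℂ] X) : Prop :=
  ∀ i j : J, i ≤ j → M i j = 0

theorem sum_abs_le_of_subset_sums {ι : Type*} (t : Finset ι) (a : ι → ℝ) (ε : ℝ)
    (h : ∀ s, s ⊆ t → |∑ k ∈ s, a k| ≤ ε) : ∑ k ∈ t, |a k| ≤ 2 * ε := by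
  classical
  rw [← Finset.sum_filter_add_sum_filter_not t (fun k => 0 ≤ a k)]
  have h1 : ∑ k ∈ t with 0 ≤ a k, |a k| = ∑ k ∈ t with 0 ≤ a k, a k :=
    Finset.sum_congr rfl fun k hk => abs_of_nonneg (Finset.mem_filter.1 hk).2
  have h2 : ∑ k ∈ t with ¬ 0 ≤ a k, |a k| = -∑ k ∈ t with ¬ 0 ≤ a k, a k := by
    rw [← Finset.sum_neg_distrib]
    exact Finset.sum_congr rfl fun k hk => abs_of_neg (not_le.1 (Finset.mem_filter.1 hk).2)
  have h3 := (abs_le.1 (h _ (Finset.filter_subset (fun k => 0 ≤ a k) t))).2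
  have h4 := (abs_le.1 (h _ (Finset.filter_subset (fun k => ¬ 0 ≤ a k) t))).1
  rw [h1, h2]
  linarith

/-- An unconditionally convergent series in a Banach space stays so after multiplication
of its terms by scalars of modulus at most one. -/
theorem summable_smul_of_summable [CompleteSpace X] {ι : Type*} {x : ι → X} (hx : Summable x)
    (c : ι → ℂ) (hc : ∀ k, ‖c k‖ ≤ 1) : Summable fun k => c k • x k := by
  rw [summable_iff_vanishing_norm] at hx ⊢
  intro ε hε
  obtain ⟨s, hs⟩ := hx (ε / 8) (by positivity)
  refine ⟨s, fun t ht => ?_⟩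
  obtain ⟨g, hg, hgx⟩ := exists_dual_vector'' ℂ (∑ k ∈ t, c k • x k)
  have key : ∀ u, u ⊆ t → ‖∑ k ∈ u, g (x k)‖ ≤ ε / 8 := fun u hu => by
    rw [← map_sum]
    have h1 := hs u (Finset.disjoint_of_subset_left hu ht)
    calc ‖g (∑ k ∈ u, x k)‖ ≤ ‖g‖ * ‖∑ k ∈ u, x k‖ := g.le_opNorm _
      _ ≤ 1 * ‖∑ k ∈ u, x k‖ := by gcongr
      _ ≤ ε / 8 := by rw [one_mul]; exact h1.le
  have hre := sum_abs_le_of_subset_sums t (fun k => (g (x k)).re) (ε / 8) fun u hu => by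
    rw [← Complex.re_sum]; exact (Complex.abs_re_le_norm _).trans (key u hu)
  have him := sum_abs_le_of_subset_sums t (fun k => (g (x k)).im) (ε / 8) fun u hu => by
    rw [← Complex.im_sum]; exact (Complex.abs_im_le_norm _).trans (key u hu)
  have h2 : ‖∑ k ∈ t, c k • x k‖ = ‖g (∑ k ∈ t, c k • x k)‖ := by
    rw [hgx]; simp
  rw [h2, map_sum]
  calc ‖∑ k ∈ t, g (c k • x k)‖ ≤ ∑ k ∈ t, ‖g (c k • x k)‖ := norm_sum_le _ _
    _ ≤ ∑ k ∈ t, (|(g (x k)).re| + |(g (x k)).im|) := by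
        refine Finset.sum_le_sum fun k _ => ?_
        rw [map_smul, smul_eq_mul, norm_mul]
        calc ‖c k‖ * ‖g (x k)‖ ≤ 1 * ‖g (x k)‖ := by gcongr; exact hc k
          _ ≤ _ := by rw [one_mul]; exact Complex.norm_le_abs_re_add_abs_im _
    _ < ε := by rw [Finset.sum_add_distrib]; linarith

theorem hasSum_rep [CompleteSpace X] {J : Set ℤ} {P : J → X →L[ℂ] X}
    (hP : IsResolutionOfIdentity P) (t : ℝ) (x : X) :
    HasSum (fun k : J => Complex.exp (Complex.I * (k : ℤ) * t) • P k x)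
      (∑' k : J, Complex.exp (Complex.I * (k : ℤ) * t) • P k x) := by
  refine (summable_smul_of_summable (hP.hasSum x).summable _ fun k => le_of_eq ?_).hasSum
  have : Complex.I * (k : ℤ) * t = (((k : ℤ) * t : ℝ) : ℂ) * Complex.I := by
    push_cast; ring
  rw [this, Complex.norm_exp_ofReal_mul_I]

/-- The representation `t ↦ T(t)` of the group `ℝ` defined by a resolution of the identity:
`T(t) x = ∑ e^{ikt} P k x`. -/
def rep [CompleteSpace X] {J : Set ℤ} {P : J → X →L[ℂ] X}
    (hP : IsResolutionOfIdentity P) (t : ℝ) : X →L[ℂ] X :=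
  continuousLinearMapOfTendsto (l := atTop)
    (f := fun x => ∑' k : J, Complex.exp (Complex.I * (k : ℤ) * t) • P k x)
    (fun s : Finset J => ∑ k ∈ s, Complex.exp (Complex.I * (k : ℤ) * t) • P k)
    (tendsto_pi_nhds.2 fun x => by simpa [HasSum] using hasSum_rep hP t x)

theorem rep_apply [CompleteSpace X] {J : Set ℤ} {P : J → X →L[ℂ] X}
    (hP : IsResolutionOfIdentity P) (t : ℝ) (x : X) :
    rep hP t x = ∑' k : J, Complex.exp (Complex.I * (k : ℤ) * t) • P k x := rfl

/-- The action of a function `f ∈ L₁(ℝ)` on a vector, in the module associated with a strongly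
continuous bounded representation `T`: `f x = ∫ f(t) T(-t) x dt`. -/
def moduleAction (T : ℝ → X →L[ℂ] X) (f : ℝ → ℂ) (x : X) : X :=
  ∫ t : ℝ, f t • T (-t) x

/-- The bounded operator `R` is the resolvent `(A - z I)⁻¹` of the (unbounded) operator `A`
at the point `z`. -/
def IsResolventAt (A : X →ₗ.[ℂ] X) (z : ℂ) (R : X →L[ℂ] X) : Prop :=
  (∀ x : X, ∃ h : R x ∈ A.domain, A ⟨R x, h⟩ - z • R x = x) ∧
    ∀ x : A.domain, R (A x - z • (x : X)) = x

/-- `A` is the generator of the Banach `L₁(ℝ)`-module associated with the representation `T`: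
`A` is closed, every non-real `z` is in its resolvent set, and `(A - z I)⁻¹` is the action of the
function `f ∈ L₁(ℝ)` whose Fourier transform `∫ f(t) e^{-iλt} dt` is `(λ - z)⁻¹`. -/
def IsModuleGenerator (T : ℝ → X →L[ℂ] X) (A : X →ₗ.[ℂ] X) : Prop :=
  A.IsClosed ∧ ∀ z : ℂ, z.im ≠ 0 → ∃ (R : X →L[ℂ] X) (f : ℝ → ℂ),
    IsResolventAt A z R ∧ Integrable f ∧
    (∀ l : ℝ, ∫ t : ℝ, f t * Complex.exp (-(Complex.I * l * t)) = ((l : ℂ) - z)⁻¹) ∧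
    ∀ x, R x = moduleAction T f x

/-- Similarity of two (unbounded) operators: there is a continuously invertible bounded `U` with
`U D(A₂) = D(A₁)` and `A₁ U x = U A₂ x` for `x ∈ D(A₂)`. -/
def AreSimilar (A₁ A₂ : X →ₗ.[ℂ] X) : Prop :=
  ∃ U : X ≃L[ℂ] X, (fun x => U x) '' (A₂.domain : Set X) = (A₁.domain : Set X) ∧
    ∀ (x : A₂.domain) (h : U (x : X) ∈ A₁.domain), A₁ ⟨U (x : X), h⟩ = U (A₂ x)

/-- The operator `A - B` with domain `D(A)`, for a bounded operator `B`. -/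
def subBounded (A : X →ₗ.[ℂ] X) (B : X →L[ℂ] X) : X →ₗ.[ℂ] X :=
  A - (B : X →ₗ[ℂ] X).toPMap ⊤

end SimilarOperators

end

/-! Relative to the projections, extended by zero to all of `ℤ`, `A` is diagonal with entries `k`.
Similarity thus asks for an invertible `W` with `A W - W A = B W`, that is `(i - j) W i j = (B W) i
j` entrywise. Up to sign and reflection of the indices, `B` is strictly upper triangular and the
factor is `j - i`. Let `b n` be the diagonal `j - i = n + 1` of `B`, and solve `u' = c u`, `u 0 =
1`, where `c r = ∑ r ^ n b n`. The `n`-th coefficient of `u` lies on the `n`-th diagonal, so the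
recursion for the coefficients is exactly the intertwining relation; formally `W = u 1`. The series
need not converge at `1`. However, `c r` is the average of `T (-θ) B T θ` against the Poisson kernel
times `exp (-iθ)`, so it is bounded on `[0, 1)` (`exists_diagonals`). Gronwall then gives `u` an
invertible limit at `1` (`exists_unit_tendsto_powSum_solCoeff`), and the entries of the limit
satisfy the relation (`exists_intertwiner`). Equality of the domains follows from a resolvent
argument far up the imaginary axis (`areSimilar_of_intertwiner`). -/

noncomputable section

namespace SimilarOperators

open Filter Topology MeasureTheory

/-! ### A linear power series ODE in a Banach algebra. -/

section PowerSeriesODE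

variable {𝔸 : Type*} [NormedRing 𝔸] [NormedAlgebra ℝ 𝔸]

/-- The sum of the power series with coefficients `a n` at the real point `r`. -/
def powSum (a : ℕ → 𝔸) (r : ℝ) : 𝔸 := ∑' n, r ^ n • a n

/-- The coefficients of the power series solution of `u' = c u`, `u 0 = 1`, where `c` is the
power series with coefficients `b n`. -/
def solCoeff (b : ℕ → 𝔸) : ℕ → 𝔸
  | 0 => 1
  | n + 1 => ((n : ℝ) + 1)⁻¹ • ∑ k : Fin (n + 1), b (n - k) * solCoeff b k
decreasing_by exact k.2

theorem solCoeff_zero (b : ℕ → 𝔸) : solCoeff b 0 = 1 := by rw [solCoeff]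

theorem solCoeff_succ (b : ℕ → 𝔸) (n : ℕ) :
    ((n : ℝ) + 1) • solCoeff b (n + 1) =
      ∑ p ∈ Finset.HasAntidiagonal.antidiagonal n, b p.1 * solCoeff b p.2 := by
  rw [solCoeff, smul_inv_smul₀ (by positivity), ← Finset.Nat.sum_antidiagonal_swap,
    Finset.Nat.sum_antidiagonal_eq_sum_range_succ_mk]
  exact Fin.sum_univ_eq_sum_range (fun k => b (n - k) * solCoeff b k) (n + 1)

variable {b : ℕ → 𝔸} {K : ℝ}

theorem norm_solCoeff_succ_le (hb : ∀ n, ‖b n‖ ≤ K) (n : ℕ) :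
    ((n : ℝ) + 1) * ‖solCoeff b (n + 1)‖ ≤ K * ∑ k ∈ Finset.range (n + 1), ‖solCoeff b k‖ := by
  have h1 : ((n : ℝ) + 1) * ‖solCoeff b (n + 1)‖ = ‖((n : ℝ) + 1) • solCoeff b (n + 1)‖ := by
    rw [norm_smul, Real.norm_of_nonneg (by positivity)]
  rw [h1, solCoeff_succ, ← Finset.Nat.sum_antidiagonal_swap,
    Finset.Nat.sum_antidiagonal_eq_sum_range_succ_mk, Finset.mul_sum]
  refine (norm_sum_le _ _).trans (Finset.sum_le_sum fun k _ => (norm_mul_le _ _).trans ?_)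
  exact mul_le_mul_of_nonneg_right (hb _) (norm_nonneg _)

/-- Ratio test: the recursion bounds each new coefficient by all earlier ones, so the partial sums,
not the coefficients, grow by a factor at most `1 + K / (n + 1)`. The same series later dominates
the termwise derivative. -/
theorem summable_sum_norm_solCoeff (hb : ∀ n, ‖b n‖ ≤ K) {r : ℝ} (hr : 0 ≤ r) (hr1 : r < 1) :
    Summable fun n => r ^ n * ∑ k ∈ Finset.range (n + 1), ‖solCoeff b k‖ := by
  have hlim : Tendsto (fun n : ℕ => (1 + K * (1 / ((n : ℝ) + 1))) * r) atTop (𝓝 r) := by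
    have h := (((tendsto_one_div_add_atTop_nhds_zero_nat (𝕜 := ℝ)).const_mul K).const_add
      1).mul_const r
    simpa using h
  refine summable_of_ratio_norm_eventually_le (r := (1 + r) / 2) (by linarith) ?_
  filter_upwards [hlim.eventually_le_const (show r < (1 + r) / 2 by linarith)] with n hn
  set s := ∑ k ∈ Finset.range (n + 1), ‖solCoeff b k‖ with hs
  have hs0 : 0 ≤ s := Finset.sum_nonneg fun _ _ => norm_nonneg _
  have h1 : ‖solCoeff b (n + 1)‖ ≤ K * (1 / ((n : ℝ) + 1)) * s := by
    have := norm_solCoeff_succ_le hb n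
    have hn0 : (0 : ℝ) < (n : ℝ) + 1 := by positivity
    rw [mul_comm, ← le_div_iff₀ hn0] at this
    refine this.trans (le_of_eq ?_)
    ring
  rw [Finset.sum_range_succ, ← hs, Real.norm_of_nonneg (by positivity),
    Real.norm_of_nonneg (by positivity)]
  calc r ^ (n + 1) * (s + ‖solCoeff b (n + 1)‖)
      ≤ r ^ (n + 1) * (s + K * (1 / ((n : ℝ) + 1)) * s) := by gcongr
    _ = ((1 + K * (1 / ((n : ℝ) + 1))) * r) * (r ^ n * s) := by ring
    _ ≤ (1 + r) / 2 * (r ^ n * s) := by gcongr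

theorem summable_norm_solCoeff (hb : ∀ n, ‖b n‖ ≤ K) {r : ℝ} (hr : |r| < 1) :
    Summable fun n => ‖r ^ n • solCoeff b n‖ := by
  refine (summable_sum_norm_solCoeff hb (abs_nonneg r) hr).of_nonneg_of_le
    (fun _ => norm_nonneg _) fun n => ?_
  rw [norm_smul, norm_pow, Real.norm_eq_abs]
  gcongr
  exact Finset.single_le_sum (f := fun k => ‖solCoeff b k‖) (fun _ _ => norm_nonneg _)
    (Finset.self_mem_range_succ n)

theorem summable_norm_pow_smul (hb : ∀ n, ‖b n‖ ≤ K) {r : ℝ} (hr : |r| < 1) :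
    Summable fun n => ‖r ^ n • b n‖ := by
  refine ((summable_geometric_of_lt_one (abs_nonneg r) hr).mul_right K).of_nonneg_of_le
    (fun _ => norm_nonneg _) fun n => ?_
  rw [norm_smul, norm_pow, Real.norm_eq_abs]
  gcongr
  exact hb n

theorem powSum_zero (a : ℕ → 𝔸) : powSum a 0 = a 0 := by
  rw [powSum, tsum_eq_single 0 fun n hn => by simp [hn]]
  simp

theorem powSum_op_neg (b : ℕ → 𝔸) (r : ℝ) :
    powSum (fun n => MulOpposite.op (-b n)) r = MulOpposite.op (-powSum b r) := by
  rw [powSum, powSum, ← tsum_neg, ← tsum_op]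
  exact tsum_congr fun n => by rw [← MulOpposite.op_smul, smul_neg]

theorem hasDerivAt_powSum_solCoeff [CompleteSpace 𝔸] (hb : ∀ n, ‖b n‖ ≤ K) {r : ℝ} (hr : |r| < 1) :
    HasDerivAt (powSum (solCoeff b)) (powSum b r * powSum (solCoeff b) r) r := by
  -- A radius strictly between `|r|` and `1` supplies one summable majorant for the derivatives on a
  -- whole ball.
  obtain ⟨ρ, hρ, hρ1⟩ := exists_between hr
  have hρ0 : 0 ≤ ρ := (abs_nonneg r).trans hρ.le
  have hsum : Summable fun n : ℕ => (n : ℝ) * ρ ^ (n - 1) * ‖solCoeff b n‖ := by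
    rw [← summable_nat_add_iff 1]
    refine ((summable_sum_norm_solCoeff hb hρ0 hρ1).mul_left K).of_nonneg_of_le
      (fun _ => by positivity) fun n => ?_
    have := mul_le_mul_of_nonneg_left (norm_solCoeff_succ_le hb n) (pow_nonneg hρ0 n)
    rw [Nat.add_sub_cancel, Nat.cast_succ]
    linarith
  have hder := hasDerivAt_tsum_of_isPreconnected (𝕜 := ℝ) (g := fun n y => y ^ n • solCoeff b n)
    (g' := fun n y => ((n : ℝ) * y ^ (n - 1)) • solCoeff b n) (t := Metric.ball 0 ρ) (y₀ := 0)
    (y := r) hsum Metric.isOpen_ball (convex_ball _ _).isPreconnected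
    (fun n y _ => (hasDerivAt_pow n y).smul_const _) (fun n y hy => ?_)
    (Metric.mem_ball_self ((abs_nonneg r).trans_lt hρ))
    (summable_norm_solCoeff hb (by simp)).of_norm (by simpa using hρ)
  · refine hder.congr_deriv ?_
    have hs' : Summable fun n : ℕ => ((n : ℝ) * r ^ (n - 1)) • solCoeff b n := by
      refine Summable.of_norm_bounded hsum fun n => ?_
      rw [norm_smul, norm_mul, norm_pow, Real.norm_natCast, Real.norm_eq_abs]
      gcongr
    rw [hs'.tsum_eq_zero_add, powSum, powSum,
      tsum_mul_tsum_eq_tsum_sum_antidiagonal_of_summable_norm (summable_norm_pow_smul hb hr)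
        (summable_norm_solCoeff hb hr)]
    simp only [Nat.cast_zero, zero_mul, zero_smul, zero_add, Nat.add_sub_cancel]
    refine tsum_congr fun n => ?_
    rw [mul_comm, mul_smul, Nat.cast_succ, solCoeff_succ, Finset.smul_sum]
    refine Finset.sum_congr rfl fun p hp => ?_
    rw [smul_mul_smul_comm, ← pow_add, Finset.HasAntidiagonal.mem_antidiagonal.1 hp]
  · rw [norm_smul, norm_mul, norm_pow, Real.norm_natCast]
    gcongr
    simpa using (Metric.mem_ball.1 hy).le

/-- A solution of a linear differential inequality on `[0, 1)` is bounded there. -/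
theorem norm_le_of_norm_deriv_le {f f' : ℝ → 𝔸}
    (hf : ∀ r, |r| < 1 → HasDerivAt f (f' r) r)
    (bound : ∀ r ∈ Set.Ico (0 : ℝ) 1, ‖f' r‖ ≤ K * ‖f r‖) (hK : 0 ≤ K) :
    ∀ r ∈ Set.Ico (0 : ℝ) 1, ‖f r‖ ≤ ‖f 0‖ * Real.exp K := by
  intro r hr
  have habs : ∀ x ∈ Set.Icc (0 : ℝ) r, |x| < 1 := fun x hx => by
    rw [abs_of_nonneg hx.1]; exact hx.2.trans_lt hr.2
  have h := norm_le_gronwallBound_of_norm_deriv_right_le (δ := ‖f 0‖) (K := K) (ε := 0)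
    (fun x hx => (hf x (habs x hx)).continuousAt.continuousWithinAt)
    (fun x hx => (hf x (habs x ⟨hx.1, hx.2.le⟩)).hasDerivWithinAt) le_rfl
    (fun x hx => by rw [add_zero]; exact bound x ⟨hx.1, hx.2.trans hr.2⟩) r ⟨hr.1, le_rfl⟩
  rw [gronwallBound_ε0] at h
  refine h.trans ?_
  gcongr
  nlinarith [hr.1, hr.2]

/-- A solution of a linear differential inequality on `[0, 1)` has a limit at `1`. -/
theorem exists_tendsto_of_norm_deriv_le [CompleteSpace 𝔸] {f f' : ℝ → 𝔸}
    (hf : ∀ r, |r| < 1 → HasDerivAt f (f' r) r)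
    (bound : ∀ r ∈ Set.Ico (0 : ℝ) 1, ‖f' r‖ ≤ K * ‖f r‖) (hK : 0 ≤ K) :
    ∃ w, Tendsto f (𝓝[<] 1) (𝓝 w) := by
  have hb := norm_le_of_norm_deriv_le hf bound hK
  have hlip : LipschitzOnWith (Real.toNNReal (K * (‖f 0‖ * Real.exp K))) f (Set.Ico 0 1) := by
    refine Convex.lipschitzOnWith_of_nnnorm_hasDerivWithin_le (f' := f') (convex_Ico 0 1)
      (fun x hx => (hf x ?_).hasDerivWithinAt) fun x hx => ?_
    · rw [abs_of_nonneg hx.1]; exact hx.2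
    · rw [← NNReal.coe_le_coe, Real.coe_toNNReal _ (by positivity), coe_nnnorm]
      exact (bound x hx).trans (mul_le_mul_of_nonneg_left (hb x hx) hK)
  have hmem : Set.Ico (0 : ℝ) 1 ∈ 𝓝[<] (1 : ℝ) := Ico_mem_nhdsLT zero_lt_one
  have hc : Cauchy (𝓝[<] (1 : ℝ)) := cauchy_nhds.mono nhdsWithin_le_nhds
  exact cauchy_map_iff_exists_tendsto.1
    (hc.map_of_le hlip.uniformContinuousOn (le_principal_iff.2 hmem))

theorem eq_zero_of_norm_deriv_le {f f' : ℝ → 𝔸}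
    (hf : ∀ r, |r| < 1 → HasDerivAt f (f' r) r)
    (bound : ∀ r ∈ Set.Ico (0 : ℝ) 1, ‖f' r‖ ≤ K * ‖f r‖) (hK : 0 ≤ K) (h0 : f 0 = 0) :
    ∀ r ∈ Set.Ico (0 : ℝ) 1, f r = 0 := fun r hr => by
  have := norm_le_of_norm_deriv_le hf bound hK r hr
  rw [h0, norm_zero, zero_mul] at this
  exact norm_le_zero_iff.1 this

/-- The power series solution of `u' = c u`, `u 0 = 1`, tends to an invertible element at `1` if
`c` is bounded on `[0, 1)`. -/
theorem exists_unit_tendsto_powSum_solCoeff [CompleteSpace 𝔸] (hb : ∀ n, ‖b n‖ ≤ K)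
    (hc : ∀ r ∈ Set.Ico (0 : ℝ) 1, ‖powSum b r‖ ≤ K) :
    ∃ w : 𝔸ˣ, Tendsto (powSum (solCoeff b)) (𝓝[<] 1) (𝓝 (w : 𝔸)) := by
  have hK : 0 ≤ K := (norm_nonneg _).trans (hb 0)
  set u := powSum (solCoeff b) with hu
  -- In the opposite ring the equation `v' = -v c` for the candidate inverse becomes a left
  -- equation, already solved by `solCoeff`.
  set b' : ℕ → 𝔸ᵐᵒᵖ := fun n => MulOpposite.op (-b n) with hb'
  have hb'K : ∀ n, ‖b' n‖ ≤ K := fun n => by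
    rw [hb', MulOpposite.norm_op, norm_neg]; exact hb n
  set v : ℝ → 𝔸 := fun r => MulOpposite.unop (powSum (solCoeff b') r) with hv
  have hud : ∀ r, |r| < 1 → HasDerivAt u (powSum b r * u r) r :=
    fun r hr => hasDerivAt_powSum_solCoeff hb hr
  have hvd : ∀ r, |r| < 1 → HasDerivAt v (-(v r * powSum b r)) r := fun r hr => by
    have h := ((MulOpposite.opContinuousLinearEquiv ℝ (M := 𝔸)).symm.hasFDerivAt.comp_hasDerivAt r
      (hasDerivAt_powSum_solCoeff hb'K hr))
    refine h.congr_deriv ?_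
    rw [show powSum b' r = MulOpposite.op (-powSum b r) from powSum_op_neg b r]
    simp [hv]
  have hu0 : u 0 = 1 := by rw [hu, powSum_zero, solCoeff_zero]
  have hv0 : v 0 = 1 := by rw [hv]; simp only [powSum_zero, solCoeff_zero, MulOpposite.unop_one]
  obtain ⟨w, hw⟩ := exists_tendsto_of_norm_deriv_le hud (K := K) (fun r hr =>
    (norm_mul_le _ _).trans (mul_le_mul_of_nonneg_right (hc r hr) (norm_nonneg _))) hK
  obtain ⟨w', hw'⟩ := exists_tendsto_of_norm_deriv_le hvd (K := K) (fun r hr => by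
    rw [norm_neg, mul_comm K]
    exact (norm_mul_le _ _).trans (mul_le_mul_of_nonneg_left (hc r hr) (norm_nonneg _))) hK
  have hvu : ∀ r ∈ Set.Ico (0 : ℝ) 1, v r * u r - 1 = 0 := by
    refine eq_zero_of_norm_deriv_le (K := 0) (f' := fun _ => 0) (fun r hr => ?_)
      (fun r _ => by simp) le_rfl (by rw [hu0, hv0, one_mul, sub_self])
    refine (((hvd r hr).mul (hud r hr)).sub_const 1).congr_deriv ?_
    noncomm_ring
  -- A left inverse need not be a right inverse here. The defect `y = u v - 1` solves `y' = c y - y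
  -- c` with `y 0 = 0`, so it vanishes by uniqueness.
  have huv : ∀ r ∈ Set.Ico (0 : ℝ) 1, u r * v r - 1 = 0 := by
    refine eq_zero_of_norm_deriv_le (K := K + K)
      (f' := fun r => powSum b r * (u r * v r - 1) - (u r * v r - 1) * powSum b r)
      (fun r hr => ?_) (fun r hr => ?_) (by positivity) (by rw [hu0, hv0, one_mul, sub_self])
    · refine (((hud r hr).mul (hvd r hr)).sub_const 1).congr_deriv ?_
      noncomm_ring
    · refine (norm_sub_le _ _).trans ?_
      rw [add_mul]
      refine add_le_add ((norm_mul_le _ _).trans ?_) ((norm_mul_le _ _).trans ?_)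
      · gcongr; exact hc r hr
      · rw [mul_comm]; gcongr; exact hc r hr
  have hmem : Set.Ico (0 : ℝ) 1 ∈ 𝓝[<] (1 : ℝ) := Ico_mem_nhdsLT zero_lt_one
  have h1 : w' * w = 1 := tendsto_nhds_unique (hw'.mul hw)
    (tendsto_const_nhds.congr' (eventually_of_mem hmem fun r hr => (sub_eq_zero.1 (hvu r hr)).symm))
  have h2 : w * w' = 1 := tendsto_nhds_unique (hw.mul hw')
    (tendsto_const_nhds.congr' (eventually_of_mem hmem fun r hr => (sub_eq_zero.1 (huv r hr)).symm))
  exact ⟨⟨w, w', h2, h1⟩, hw⟩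

end PowerSeriesODE

/-! ### Fourier coefficients of exponentials and of the Poisson kernel. -/

section Kernels

theorem integral_exp_int_mul (m : ℤ) :
    ∫ θ in (0 : ℝ)..2 * Real.pi, Complex.exp (Complex.I * m * θ) =
      if m = 0 then 2 * (Real.pi : ℂ) else 0 := by
  split_ifs with h
  · simp [h]
  · rw [integral_exp_mul_complex (mul_ne_zero Complex.I_ne_zero (Int.cast_ne_zero.2 h))]
    have : Complex.exp (Complex.I * m * ((2 * Real.pi : ℝ) : ℂ)) = 1 := by
      rw [Complex.exp_eq_one_iff]
      exact ⟨m, by push_cast; ring⟩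
    rw [this]
    simp

/-- The Poisson kernel on the unit circle, as a function of the angle. -/
def poisson (r θ : ℝ) : ℝ := poissonKernel 0 (r : ℂ) (circleMap 0 1 θ)

variable {r : ℝ}

theorem poisson_eq (r θ : ℝ) :
    poisson r θ = (1 - r ^ 2) / ‖circleMap 0 1 θ - r‖ ^ 2 := by
  simp [poisson, poissonKernel_def]

theorem continuous_poisson (hr : r ∈ Set.Ico (0 : ℝ) 1) : Continuous (poisson r) := by
  have h : ∀ θ : ℝ, ‖circleMap 0 1 θ - (r : ℂ)‖ ^ 2 ≠ 0 := fun θ h0 => by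
    have h1 := sub_eq_zero.1 (norm_eq_zero.1 (pow_eq_zero_iff two_ne_zero |>.1 h0))
    have h2 := congrArg norm h1
    rw [norm_circleMap_zero, abs_one, Complex.norm_real, Real.norm_of_nonneg hr.1] at h2
    exact hr.2.ne h2.symm
  have : poisson r = fun θ => (1 - r ^ 2) / ‖circleMap 0 1 θ - r‖ ^ 2 := funext (poisson_eq r)
  rw [this]
  exact continuous_const.div (by fun_prop) h

theorem poisson_nonneg (hr : r ∈ Set.Ico (0 : ℝ) 1) (θ : ℝ) : 0 ≤ poisson r θ := by
  rw [poisson_eq]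
  have : r ^ 2 ≤ 1 := pow_le_one₀ hr.1 hr.2.le
  exact div_nonneg (by linarith) (by positivity)

/-- The Poisson integral reproduces the holomorphic function `z ^ n` at the interior point `r`. -/
theorem integral_poisson_mul_exp (hr : r ∈ Set.Ico (0 : ℝ) 1) (n : ℕ) :
    ∫ θ in (0 : ℝ)..2 * Real.pi, (poisson r θ : ℂ) * Complex.exp (Complex.I * n * θ) =
      2 * Real.pi * r ^ n := by
  have hw : (r : ℂ) ∈ Metric.ball (0 : ℂ) 1 := by
    simp [abs_of_nonneg hr.1, hr.2]
  have hf : DiffContOnCl ℂ (fun z : ℂ => z ^ n) (Metric.ball 0 1) :=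
    (differentiable_id.pow n).diffContOnCl
  have h := hf.circleAverage_poissonKernel_smul hw
  rw [Real.circleAverage_def, inv_smul_eq_iff₀ (by positivity)] at h
  simp only [Pi.smul_apply', Complex.real_smul, Complex.ofReal_mul, Complex.ofReal_ofNat] at h
  rw [← h]
  refine intervalIntegral.integral_congr fun θ _ => ?_
  simp only [poisson, circleMap_zero, Complex.ofReal_one, one_mul, ← Complex.exp_nat_mul]
  congr 2
  ring

theorem integral_poisson (hr : r ∈ Set.Ico (0 : ℝ) 1) :
    ∫ θ in (0 : ℝ)..2 * Real.pi, poisson r θ = 2 * Real.pi := by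
  have h := integral_poisson_mul_exp hr 0
  simp only [Nat.cast_zero, mul_zero, zero_mul, Complex.exp_zero, mul_one, pow_zero] at h
  rw [intervalIntegral.integral_ofReal] at h
  exact_mod_cast h

end Kernels

/-! ### Resolutions of the identity over `ℤ` and their rotation groups. -/

variable {X : Type*} [NormedAddCommGroup X] [NormedSpace ℂ X]

/-- A norming functional reduces this to scalars; the factor 4 comes from splitting real and
imaginary parts by sign. -/
theorem norm_sum_smul_le {ι : Type*} {x : ι → X} (t : Finset ι) {ε : ℝ}
    (h : ∀ s, s ⊆ t → ‖∑ k ∈ s, x k‖ ≤ ε) (c : ι → ℂ) (hc : ∀ k, ‖c k‖ ≤ 1) :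
    ‖∑ k ∈ t, c k • x k‖ ≤ 4 * ε := by
  obtain ⟨g, hg, hgx⟩ := exists_dual_vector'' ℂ (∑ k ∈ t, c k • x k)
  have key : ∀ u, u ⊆ t → ‖∑ k ∈ u, g (x k)‖ ≤ ε := fun u hu => by
    rw [← map_sum]
    exact ((g.le_opNorm _).trans (mul_le_of_le_one_left (norm_nonneg _) hg)).trans (h u hu)
  have hre := sum_abs_le_of_subset_sums t (fun k => (g (x k)).re) ε fun u hu => by
    rw [← Complex.re_sum]; exact (Complex.abs_re_le_norm _).trans (key u hu)
  have him := sum_abs_le_of_subset_sums t (fun k => (g (x k)).im) ε fun u hu => by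
    rw [← Complex.im_sum]; exact (Complex.abs_im_le_norm _).trans (key u hu)
  have h2 : ‖∑ k ∈ t, c k • x k‖ = ‖g (∑ k ∈ t, c k • x k)‖ := by
    rw [hgx]; simp
  rw [h2, map_sum]
  calc ‖∑ k ∈ t, g (c k • x k)‖ ≤ ∑ k ∈ t, ‖g (c k • x k)‖ := norm_sum_le _ _
    _ ≤ ∑ k ∈ t, (|(g (x k)).re| + |(g (x k)).im|) := by
        refine Finset.sum_le_sum fun k _ => ?_
        rw [map_smul, smul_eq_mul, norm_mul]
        exact (mul_le_of_le_one_left (norm_nonneg _) (hc k)).trans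
          (Complex.norm_le_abs_re_add_abs_im _)
    _ ≤ 4 * ε := by rw [Finset.sum_add_distrib]; linarith

/-- A resolution of the identity indexed by all the integers, with zero projections allowed. -/
structure IsIntResolution (Q : ℤ → X →L[ℂ] X) : Prop where
  apply_self : ∀ k x, Q k (Q k x) = Q k x
  apply_ne : ∀ i j, i ≠ j → ∀ x, Q i (Q j x) = 0
  hasSum : ∀ x, HasSum (fun k => Q k x) x

namespace IsIntResolution

variable {Q : ℤ → X →L[ℂ] X} (hQ : IsIntResolution Q)
include hQ

theorem ext_left {y z : X} (h : ∀ i, Q i y = Q i z) : y = z :=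
  (hQ.hasSum y).unique (by simpa only [h] using hQ.hasSum z)

theorem ext_right {Y Z : X →L[ℂ] X} (h : ∀ j x, Y (Q j x) = Z (Q j x)) : Y = Z := by
  ext x
  refine ((hQ.hasSum x).mapL Y).unique ?_
  simpa only [h] using (hQ.hasSum x).mapL Z

theorem ext_entries {Y Z : X →L[ℂ] X} (h : ∀ i j x, Q i (Y (Q j x)) = Q i (Z (Q j x))) : Y = Z :=
  hQ.ext_right fun j x => hQ.ext_left fun i => h i j x

theorem comp_diag {D : X →L[ℂ] X} {c : ℤ → ℂ} (hD : ∀ x, HasSum (fun k => c k • Q k x) (D x))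
    (k : ℤ) (x : X) : Q k (D x) = c k • Q k x := by
  refine ((hD x).mapL (Q k)).unique ?_
  convert hasSum_single k fun j hj => ?_ using 1
  · rw [map_smul, hQ.apply_self]
  · rw [map_smul, hQ.apply_ne _ _ hj.symm, smul_zero]

theorem diag_comp {D : X →L[ℂ] X} {c : ℤ → ℂ} (hD : ∀ x, HasSum (fun k => c k • Q k x) (D x))
    (k : ℤ) (x : X) : D (Q k x) = c k • Q k x := by
  refine (hD (Q k x)).unique ?_
  convert hasSum_single k fun j hj => ?_ using 1
  · rw [hQ.apply_self]
  · rw [hQ.apply_ne _ _ hj, smul_zero]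

/-- Unconditional convergence bounds the partial sums over all finite sets pointwise, and
Banach–Steinhaus makes the bound uniform. It controls every diagonal operator with entries of
modulus at most one, in particular `T t` and the scaled resolvents. -/
theorem exists_norm_sum_smul_le [CompleteSpace X] : ∃ M : ℝ, 0 ≤ M ∧ ∀ c : ℤ → ℂ,
    (∀ k, ‖c k‖ ≤ 1) → ∀ (F : Finset ℤ) (x : X), ‖∑ k ∈ F, c k • Q k x‖ ≤ M * ‖x‖ := by
  obtain ⟨C, hC⟩ := banach_steinhaus (g := fun F : Finset ℤ => ∑ k ∈ F, Q k) fun x => by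
    obtain ⟨s, hs⟩ := summable_iff_vanishing_norm.1 (hQ.hasSum x).summable 1 one_pos
    refine ⟨(∑ k ∈ s, ‖Q k x‖) + 1, fun F => ?_⟩
    rw [sum_apply, ← Finset.sum_inter_add_sum_sdiff F s]
    refine (norm_add_le _ _).trans (add_le_add ((norm_sum_le _ _).trans ?_)
      (hs _ Finset.sdiff_disjoint).le)
    exact Finset.sum_le_sum_of_subset_of_nonneg Finset.inter_subset_right
      fun _ _ _ => norm_nonneg _
  refine ⟨4 * C, mul_nonneg zero_le_four ((norm_nonneg _).trans (hC ∅)), fun c hc F x => ?_⟩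
  rw [mul_assoc]
  refine norm_sum_smul_le F (fun s _ => ?_) c hc
  rw [← sum_apply]
  exact (ContinuousLinearMap.le_opNorm _ _).trans
    (mul_le_mul_of_nonneg_right (hC s) (norm_nonneg _))

theorem dense_setOf_finset_sum : Dense {x | ∃ F : Finset ℤ, ∑ k ∈ F, Q k x = x} := by
  classical
  intro x
  refine mem_closure_of_tendsto (hQ.hasSum x) (Eventually.of_forall fun F => ⟨F, ?_⟩)
  refine Finset.sum_congr rfl fun k hk => ?_
  rw [map_sum, Finset.sum_eq_single_of_mem k hk fun j _ hj => hQ.apply_ne _ _ hj.symm x,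
    hQ.apply_self]

end IsIntResolution

/-- `T` is the representation `T(t) x = ∑ e^{ikt} Q k x` of the group `ℝ`. -/
def IsRotation (Q : ℤ → X →L[ℂ] X) (T : ℝ → X →L[ℂ] X) : Prop :=
  ∀ (t : ℝ) (x : X), HasSum (fun k : ℤ => Complex.exp (Complex.I * k * t) • Q k x) (T t x)

theorem norm_exp_I_mul (k : ℤ) (t : ℝ) : ‖Complex.exp (Complex.I * k * t)‖ = 1 := by
  have : Complex.I * k * t = ((k * t : ℝ) : ℂ) * Complex.I := by push_cast; ring
  rw [this, Complex.norm_exp_ofReal_mul_I]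

theorem norm_le_of_hasSum_smul {Q : ℤ → X →L[ℂ] X} {M : ℝ}
    (hM : ∀ c : ℤ → ℂ, (∀ k, ‖c k‖ ≤ 1) → ∀ (F : Finset ℤ) (x : X),
      ‖∑ k ∈ F, c k • Q k x‖ ≤ M * ‖x‖) {c : ℤ → ℂ} (hc : ∀ k, ‖c k‖ ≤ 1) {x y : X}
    (h : HasSum (fun k => c k • Q k x) y) : ‖y‖ ≤ M * ‖x‖ :=
  le_of_tendsto h.norm (Eventually.of_forall fun F => hM c hc F x)

theorem IsIntResolution.exists_isRotation [CompleteSpace X] {Q : ℤ → X →L[ℂ] X}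
    (hQ : IsIntResolution Q) : ∃ T, IsRotation Q T := by
  have h : ∀ (t : ℝ) x, Summable fun k : ℤ => Complex.exp (Complex.I * k * t) • Q k x :=
    fun t x => summable_smul_of_summable (hQ.hasSum x).summable _ fun k => (norm_exp_I_mul k t).le
  refine ⟨fun t => continuousLinearMapOfTendsto (l := atTop)
    (f := fun x => ∑' k : ℤ, Complex.exp (Complex.I * k * t) • Q k x)
    (fun s : Finset ℤ => ∑ k ∈ s, Complex.exp (Complex.I * k * t) • Q k)
    (tendsto_pi_nhds.2 fun x => ?_), fun t x => (h t x).hasSum⟩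
  simpa [HasSum] using (h t x).hasSum

theorem IsRotation.continuous_uncurry [CompleteSpace X] {Q : ℤ → X →L[ℂ] X} {T : ℝ → X →L[ℂ] X}
    (hT : IsRotation Q T) (hQ : IsIntResolution Q) : Continuous fun p : X × ℝ => T p.2 p.1 := by
  obtain ⟨M, hM0, hM⟩ := hQ.exists_norm_sum_smul_le
  refine continuous_prod_of_dense_continuous_lipschitzWith _ M.toNNReal hQ.dense_setOf_finset_sum
    (fun x hx => ?_) fun t => ?_
  · obtain ⟨F, hF⟩ := hx
    have : (fun t => T t x) = fun t : ℝ => ∑ k ∈ F, Complex.exp (Complex.I * k * t) • Q k x := by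
      ext t
      conv_lhs => rw [← hF, map_sum]
      exact Finset.sum_congr rfl fun k _ => hQ.diag_comp (hT t) k x
    simp only [this]
    fun_prop
  · refine AddMonoidHomClass.lipschitz_of_bound (T t) M fun x => ?_
    exact norm_le_of_hasSum_smul hM (fun k => (norm_exp_I_mul k t).le) (hT t x)

/-! ### Diagonals of an operator matrix as Fourier coefficients. -/

/-- Multiplication of the entries of an operator matrix along its diagonals by the Fourier
coefficients of a function is bounded by the `L₁` norm of the function. -/
theorem IsIntResolution.exists_multiplier [CompleteSpace X] {Q : ℤ → X →L[ℂ] X}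
    (hQ : IsIntResolution Q) (B : X →L[ℂ] X) : ∃ C : ℝ, 0 ≤ C ∧ ∀ p : ℝ → ℂ, Continuous p →
      ∃ Φ : X →L[ℂ] X, ‖Φ‖ ≤ C * ∫ θ in (0 : ℝ)..2 * Real.pi, ‖p θ‖ ∧
        ∀ (i j : ℤ) x, Q i (Φ (Q j x)) = (∫ θ in (0 : ℝ)..2 * Real.pi,
          p θ * Complex.exp (Complex.I * ((j - i : ℤ) : ℂ) * θ)) • Q i (B (Q j x)) := by
  obtain ⟨T, hT⟩ := hQ.exists_isRotation
  obtain ⟨M, hM0, hM⟩ := hQ.exists_norm_sum_smul_le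
  have hTM : ∀ t x, ‖T t x‖ ≤ M * ‖x‖ := fun t x =>
    norm_le_of_hasSum_smul hM (fun k => (norm_exp_I_mul k t).le) (hT t x)
  have hTc := hT.continuous_uncurry hQ
  -- The operator is the integral of `p θ • T (-θ) B T θ`: the conjugation multiplies entry `(i, j)`
  -- by `exp (i(j - i)θ)` and has norm at most `M * (‖B‖ * M)`.
  refine ⟨M * (‖B‖ * M), by positivity, fun p hp => ?_⟩
  have hc : ∀ x, Continuous fun θ => p θ • T (-θ) (B (T θ x)) := fun x => by
    refine hp.smul (hTc.comp (f := fun θ => (B (T θ x), -θ)) ?_)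
    have := hTc.comp (f := fun θ => (x, θ)) (by fun_prop)
    exact (B.continuous.comp this).prodMk continuous_neg
  have h2pi : (0 : ℝ) ≤ 2 * Real.pi := by positivity
  have hbound : ∀ x, ‖∫ θ in (0 : ℝ)..2 * Real.pi, p θ • T (-θ) (B (T θ x))‖ ≤
      (M * (‖B‖ * M) * ∫ θ in (0 : ℝ)..2 * Real.pi, ‖p θ‖) * ‖x‖ := fun x => by
    rw [← intervalIntegral.integral_const_mul, ← intervalIntegral.integral_mul_const]
    refine intervalIntegral.norm_integral_le_of_norm_le h2pi (ae_of_all _ fun θ _ => ?_)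
      (Continuous.intervalIntegrable (by fun_prop) _ _)
    rw [norm_smul]
    calc ‖p θ‖ * ‖T (-θ) (B (T θ x))‖ ≤ ‖p θ‖ * (M * (‖B‖ * (M * ‖x‖))) := by
          refine mul_le_mul_of_nonneg_left ((hTM _ _).trans ?_) (norm_nonneg _)
          refine mul_le_mul_of_nonneg_left ((B.le_opNorm _).trans ?_) hM0
          exact mul_le_mul_of_nonneg_left (hTM _ _) (norm_nonneg _)
      _ = M * (‖B‖ * M) * ‖p θ‖ * ‖x‖ := by ring
  refine ⟨LinearMap.mkContinuous
    { toFun := fun x => ∫ θ in (0 : ℝ)..2 * Real.pi, p θ • T (-θ) (B (T θ x))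
      map_add' := fun x y => ?_
      map_smul' := fun a x => ?_ } _ hbound, LinearMap.mkContinuous_norm_le _ ?_ _,
    fun i j x => ?_⟩
  · simp only [map_add, smul_add]
    exact intervalIntegral.integral_add ((hc x).intervalIntegrable _ _)
      ((hc y).intervalIntegrable _ _)
  · simp only [map_smul, smul_comm _ a, RingHom.id_apply]
    exact intervalIntegral.integral_smul a _
  · exact mul_nonneg (by positivity)
      (intervalIntegral.integral_nonneg h2pi fun _ _ => norm_nonneg _)
  · rw [LinearMap.mkContinuous_apply, LinearMap.coe_mk, AddHom.coe_mk,
      ← ContinuousLinearMap.intervalIntegral_comp_comm _ ((hc _).intervalIntegrable _ _),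
      ← intervalIntegral.integral_smul_const]
    refine intervalIntegral.integral_congr fun θ _ => ?_
    simp only [map_smul]
    rw [hQ.diag_comp (hT θ), map_smul, map_smul, map_smul, hQ.comp_diag (hT (-θ)), smul_smul,
      smul_smul, mul_assoc, ← Complex.exp_add]
    congr 3
    push_cast
    ring

/-- The `(i, j)` entry of an operator matrix, applied to a vector, as a function of the operator. -/
def entry (Q : ℤ → X →L[ℂ] X) (i j : ℤ) (x : X) : (X →L[ℂ] X) →L[ℂ] X :=
  (Q i).comp (ContinuousLinearMap.apply ℂ X (Q j x))

theorem entry_apply (Q : ℤ → X →L[ℂ] X) (i j : ℤ) (x : X) (Y : X →L[ℂ] X) :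
    entry Q i j x Y = Q i (Y (Q j x)) := rfl

theorem hasSum_entry_powSum (Q : ℤ → X →L[ℂ] X) [CompleteSpace X] {a : ℕ → X →L[ℂ] X} {r : ℝ}
    (h : Summable fun n => ‖r ^ n • a n‖) (i j : ℤ) (x : X) :
    HasSum (fun n => ((r : ℂ) ^ n) • Q i (a n (Q j x))) (Q i (powSum a r (Q j x))) := by
  have h1 := h.of_norm.hasSum.mapL (entry Q i j x)
  convert h1 using 2 with n
  swap
  · rfl
  rw [← Complex.coe_smul, map_smul, entry_apply, Complex.ofReal_pow]

variable {Q : ℤ → X →L[ℂ] X}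

/-- The diagonals of a strictly upper triangular operator form a power series that is bounded
on `[0, 1)`. -/
theorem IsIntResolution.exists_diagonals [CompleteSpace X] (hQ : IsIntResolution Q)
    {B : X →L[ℂ] X} (hB : ∀ i j x, j ≤ i → Q i (B (Q j x)) = 0) :
    ∃ (C : ℝ) (b : ℕ → X →L[ℂ] X), (∀ n, ‖b n‖ ≤ C) ∧
      (∀ (n : ℕ) i j x, Q i (b n (Q j x)) = if j - i = n + 1 then Q i (B (Q j x)) else 0) ∧
      ∀ r ∈ Set.Ico (0 : ℝ) 1, ‖powSum b r‖ ≤ C := by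
  obtain ⟨C, hC0, hC⟩ := hQ.exists_multiplier B
  have hpi : (2 * (Real.pi : ℂ)) ≠ 0 := by simp [Real.pi_ne_zero]
  have h1 : ∀ n : ℕ, ∃ b : X →L[ℂ] X, ‖b‖ ≤ C * (2 * Real.pi) ∧ ∀ i j x,
      Q i (b (Q j x)) = if j - i = n + 1 then Q i (B (Q j x)) else 0 := fun n => by
    obtain ⟨Φ, hΦ, hΦe⟩ := hC
      (fun θ => Complex.exp (Complex.I * ((-(n + 1) : ℤ) : ℂ) * θ)) (by fun_prop)
    refine ⟨(2 * (Real.pi : ℂ))⁻¹ • Φ, ?_, fun i j x => ?_⟩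
    · simp only [norm_exp_I_mul, intervalIntegral.integral_const, smul_eq_mul, sub_zero,
        mul_one] at hΦ
      refine (norm_smul_le _ _).trans ((mul_le_of_le_one_left (norm_nonneg _) ?_).trans hΦ)
      rw [norm_inv, norm_mul, Complex.norm_real, Real.norm_of_nonneg Real.pi_pos.le,
        Complex.norm_ofNat]
      exact inv_le_one_of_one_le₀ (by linarith [Real.pi_gt_three])
    · rw [smul_apply, map_smul, hΦe, smul_smul]
      have : ∫ θ in (0 : ℝ)..2 * Real.pi, Complex.exp (Complex.I * ((-(n + 1) : ℤ) : ℂ) * θ) *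
          Complex.exp (Complex.I * ((j - i : ℤ) : ℂ) * θ) =
          if j - i = n + 1 then 2 * (Real.pi : ℂ) else 0 := by
        rw [if_congr (show j - i = n + 1 ↔ j - i - (n + 1) = 0 by omega) rfl rfl,
          ← integral_exp_int_mul]
        refine intervalIntegral.integral_congr fun θ _ => ?_
        simp only [← Complex.exp_add]
        congr 1
        push_cast
        ring
      rw [this]
      split_ifs
      · rw [inv_mul_cancel₀ hpi, one_smul]
      · rw [mul_zero, zero_smul]
  choose b hb hbe using h1
  refine ⟨C * (2 * Real.pi), b, hb, hbe, fun r hr => ?_⟩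
  have habs : |r| < 1 := by rw [abs_of_nonneg hr.1]; exact hr.2
  -- The factor `exp (-iθ)` accounts for `b m` lying on diagonal `m + 1`, where the coefficient
  -- becomes `2π r ^ m`. The kernel is nonnegative of mass `2π`, so the bound is independent of `r`;
  -- coefficients with `j ≤ i` meet zero entries of `B`.
  obtain ⟨Φ, hΦ, hΦe⟩ := hC
    (fun θ => poisson r θ * Complex.exp (Complex.I * ((-1 : ℤ) : ℂ) * θ))
    ((Complex.continuous_ofReal.comp (continuous_poisson hr)).mul (by fun_prop))
  have hΦn : ‖Φ‖ ≤ C * (2 * Real.pi) := by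
    refine hΦ.trans (le_of_eq ?_)
    congr 1
    refine Eq.trans (intervalIntegral.integral_congr fun θ _ => ?_) (integral_poisson hr)
    simp only [norm_mul, norm_exp_I_mul, mul_one, Complex.norm_real]
    exact Real.norm_of_nonneg (poisson_nonneg hr θ)
  have hcΦ : powSum b r = (2 * (Real.pi : ℂ))⁻¹ • Φ := by
    refine hQ.ext_entries fun i j x => ?_
    have hs := hasSum_entry_powSum Q (summable_norm_pow_smul (𝔸 := X →L[ℂ] X) hb habs) i j x
    simp only [hbe] at hs
    rw [smul_apply, map_smul, hΦe]
    rcases le_or_gt j i with hji | hij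
    · rw [hB i j x hji, smul_zero, smul_zero]
      refine hs.unique ?_
      simp only [hB i j x hji, ite_self, smul_zero]
      exact hasSum_zero
    · obtain ⟨m, hm⟩ := Int.eq_ofNat_of_zero_le (show 0 ≤ j - i - 1 by omega)
      have : ∫ θ in (0 : ℝ)..2 * Real.pi, (poisson r θ *
          Complex.exp (Complex.I * ((-1 : ℤ) : ℂ) * θ)) *
          Complex.exp (Complex.I * ((j - i : ℤ) : ℂ) * θ) = 2 * Real.pi * r ^ m := by
        rw [← integral_poisson_mul_exp hr]
        refine intervalIntegral.integral_congr fun θ _ => ?_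
        simp only [mul_assoc, ← Complex.exp_add]
        congr 2
        rw [show j - i = m + 1 by omega]
        push_cast
        ring
      rw [this, smul_smul, ← mul_assoc, inv_mul_cancel₀ hpi, one_mul]
      refine hs.unique ?_
      convert hasSum_single m fun n hn => ?_ using 1
      · rw [if_pos (by omega)]
      · rw [if_neg (by omega), smul_zero]
  rw [hcΦ]
  refine (norm_smul_le _ _).trans ((mul_le_of_le_one_left (norm_nonneg _) ?_).trans hΦn)
  rw [norm_inv, norm_mul, Complex.norm_real, Real.norm_of_nonneg Real.pi_pos.le,
    Complex.norm_ofNat]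
  exact inv_le_one_of_one_le₀ (by linarith [Real.pi_gt_three])

theorem succ_smul_solCoeff_apply (b : ℕ → X →L[ℂ] X) (n : ℕ) (y : X) :
    ((n : ℂ) + 1) • solCoeff b (n + 1) y =
      ∑ p ∈ Finset.HasAntidiagonal.antidiagonal n, b p.1 (solCoeff b p.2 y) := by
  have := DFunLike.congr_fun (solCoeff_succ b n) y
  rw [← Complex.coe_smul] at this
  simpa using this

/-! ### The intertwining operator. -/

section Intertwiner

variable {B : X →L[ℂ] X} {b : ℕ → X →L[ℂ] X}
  (hbe : ∀ (n : ℕ) i j x, Q i (b n (Q j x)) = if j - i = n + 1 then Q i (B (Q j x)) else 0)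
include hbe

theorem IsIntResolution.diagonal_comp (hQ : IsIntResolution Q) (n : ℕ) (i : ℤ) (x : X) :
    b n (Q (i + n + 1) x) = Q i (B (Q (i + n + 1) x)) := by
  refine hQ.ext_left fun k => ?_
  rw [hbe]
  split_ifs with h
  · obtain rfl : k = i := by omega
    rw [hQ.apply_self]
  · rw [hQ.apply_ne k i (by omega)]

theorem IsIntResolution.comp_diagonal (hQ : IsIntResolution Q) (n : ℕ) (i : ℤ) (x : X) :
    Q i (b n x) = b n (Q (i + n + 1) x) := by
  have : (Q i).comp (b n) = (b n).comp (Q (i + n + 1)) := by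
    refine hQ.ext_right fun j y => ?_
    simp only [ContinuousLinearMap.comp_apply, hbe]
    split_ifs with h
    · obtain rfl : j = i + n + 1 := by omega
      rw [hQ.apply_self, hQ.diagonal_comp hbe]
    · rw [hQ.apply_ne _ j (by omega), map_zero]
  exact DFunLike.congr_fun this x

/-- Degree count: `b p` shifts the index by `p + 1`, so every term of the recursion for coefficient
`n + 1` shifts by `n + 1`. Hence each entry of `powSum (solCoeff b) r` is a single monomial in `r`,
or zero. -/
theorem IsIntResolution.comp_solCoeff (hQ : IsIntResolution Q) (n : ℕ) :
    ∀ (i : ℤ) (x : X), Q i (solCoeff b n x) = solCoeff b n (Q (i + n) x) := by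
  induction n using Nat.strong_induction_on with
  | _ n ih =>
    intro i x
    rcases n with _ | n
    · simp [solCoeff_zero]
    · have h0 : (n : ℂ) + 1 ≠ 0 := Nat.cast_add_one_ne_zero n
      refine (smul_right_injective X h0) ?_
      simp only
      rw [← map_smul, succ_smul_solCoeff_apply, succ_smul_solCoeff_apply, map_sum]
      refine Finset.sum_congr rfl fun p hp => ?_
      have hp' := Finset.HasAntidiagonal.mem_antidiagonal.1 hp
      rw [hQ.comp_diagonal hbe, ih _ (by omega)]
      congr 4
      push_cast
      omega

end Intertwiner

/-- A strictly upper triangular perturbation has an invertible intertwiner. -/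
theorem IsIntResolution.exists_intertwiner [CompleteSpace X] (hQ : IsIntResolution Q)
    {B : X →L[ℂ] X} (hB : ∀ i j x, j ≤ i → Q i (B (Q j x)) = 0) :
    ∃ W : (X →L[ℂ] X)ˣ, ∀ (i j : ℤ) x,
      ((j - i : ℤ) : ℂ) • Q i (W.val (Q j x)) = Q i (B (W.val (Q j x))) := by
  obtain ⟨C, b, hb, hbe, hbr⟩ := hQ.exists_diagonals hB
  obtain ⟨W, hW⟩ := exists_unit_tendsto_powSum_solCoeff hb hbr
  have hmem : Set.Ico (0 : ℝ) 1 ∈ 𝓝[<] (1 : ℝ) := Ico_mem_nhdsLT zero_lt_one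
  have hlim : ∀ i j x, Tendsto (fun r => Q i (powSum (solCoeff b) r (Q j x))) (𝓝[<] 1)
      (𝓝 (Q i (W.val (Q j x)))) := fun i j x =>
    ((entry Q i j x).continuous.tendsto _).comp hW
  have hterm : ∀ r ∈ Set.Ico (0 : ℝ) 1, ∀ i j x,
      HasSum (fun n : ℕ => ((r : ℂ) ^ n) • solCoeff b n (Q (i + n) (Q j x)))
        (Q i (powSum (solCoeff b) r (Q j x))) := fun r hr i j x => by
    have habs : |r| < 1 := by rw [abs_of_nonneg hr.1]; exact hr.2
    have := hasSum_entry_powSum Q (summable_norm_solCoeff hb habs) i j x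
    simpa only [hQ.comp_solCoeff hbe] using this
  have hlow : ∀ i j x, j < i → Q i (W.val (Q j x)) = 0 := fun i j x hji => by
    refine tendsto_nhds_unique (hlim i j x) (tendsto_const_nhds.congr'
      (eventually_of_mem hmem fun r hr => (HasSum.unique (hterm r hr i j x) ?_).symm))
    convert hasSum_zero with n
    rw [hQ.apply_ne _ _ (by omega), map_zero, smul_zero]
  have hup : ∀ (m : ℕ) i x, Q i (W.val (Q (i + m) x)) = solCoeff b m (Q (i + m) x) := by
    intro m i x
    have h1 : ∀ r ∈ Set.Ico (0 : ℝ) 1, Q i (powSum (solCoeff b) r (Q (i + m) x)) =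
        ((r : ℂ) ^ m) • solCoeff b m (Q (i + m) x) := fun r hr => by
      refine (hterm r hr i _ x).unique ?_
      convert hasSum_single m fun n hn => ?_ using 1
      · rw [hQ.apply_self]
      · rw [hQ.apply_ne _ _ (by omega), map_zero, smul_zero]
    refine tendsto_nhds_unique (hlim i _ x) (Tendsto.congr'
      (eventually_of_mem hmem fun r hr => (h1 r hr).symm) ?_)
    have h2 : Continuous fun r : ℝ => ((r : ℂ) ^ m) • solCoeff b m (Q (i + m) x) := by fun_prop
    have h3 := (h2.tendsto 1).mono_left (nhdsWithin_le_nhds (s := Set.Iio 1))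
    simpa using h3
  refine ⟨W, fun i j x => ?_⟩
  -- Expand the matrix product `B W` over the intermediate index `l`. Only `i < l ≤ j` contributes,
  -- and this finite sum is the recursion for the coefficient of index `j - i`.
  have hsum := (hQ.hasSum (W.val (Q j x))).mapL ((Q i).comp B)
  simp only [ContinuousLinearMap.comp_apply] at hsum
  refine HasSum.unique ?_ hsum
  rcases le_or_gt j i with hji | hij
  · have hz : ((j - i : ℤ) : ℂ) • Q i (W.val (Q j x)) = 0 := by
      rcases hji.eq_or_lt with rfl | hlt
      · simp
      · rw [hlow i j x hlt, smul_zero]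
    rw [hz]
    convert hasSum_zero with l
    rcases le_or_gt l i with hl | hl
    · exact hB i l _ hl
    · rw [hlow l j x (hji.trans_lt hl), map_zero, map_zero]
  · obtain ⟨m, hm⟩ := Int.eq_ofNat_of_zero_le (show 0 ≤ j - i - 1 by omega)
    obtain rfl : j = i + ((m + 1 : ℕ) : ℤ) := by push_cast; omega
    have hinj : Function.Injective fun k : ℕ => i + k + 1 := fun a c h => by
      simp only at h; omega
    rw [← hinj.hasSum_iff fun l hl => hB i l _ (by
      by_contra hlt
      obtain ⟨k, hk⟩ := Int.eq_ofNat_of_zero_le (show 0 ≤ l - i - 1 by omega)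
      exact hl ⟨k, by simp only; omega⟩)]
    have hcast : ((i + ((m + 1 : ℕ) : ℤ) - i : ℤ) : ℂ) = (m : ℂ) + 1 := by push_cast; ring
    rw [hcast, hup, succ_smul_solCoeff_apply, Finset.Nat.sum_antidiagonal_eq_sum_range_succ_mk]
    have h := hasSum_sum_of_ne_finset_zero (L := SummationFilter.unconditional ℕ)
      (f := fun k : ℕ => Q i (B (Q (i + k + 1) (W.val (Q (i + ((m + 1 : ℕ) : ℤ)) x)))))
      (s := Finset.range m.succ) fun k hk => by
        rw [hlow _ _ _ (by rw [Finset.mem_range] at hk; omega), map_zero, map_zero]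
    convert h using 1
    · rfl
    refine Finset.sum_congr rfl fun k hk => ?_
    rw [Finset.mem_range] at hk
    have e : i + ((m + 1 : ℕ) : ℤ) = (i + k + 1) + ((m - k : ℕ) : ℤ) := by omega
    rw [e, ← hup, hQ.diagonal_comp hbe]

/-- Reversing the order of the indices exchanges lower and upper triangular matrices. -/
theorem IsIntResolution.comp_neg (hQ : IsIntResolution Q) : IsIntResolution fun k => Q (-k) where
  apply_self _ x := hQ.apply_self _ x
  apply_ne _ _ h x := hQ.apply_ne _ _ (neg_injective.ne h) x
  hasSum x := (Equiv.neg ℤ).hasSum_iff.2 (hQ.hasSum x)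

/-! ### Domains and similarity. -/

theorem mem_domain_subBounded {A : X →ₗ.[ℂ] X} {B : X →L[ℂ] X} {x : X} :
    x ∈ (subBounded A B).domain ↔ x ∈ A.domain := by
  simp [subBounded, LinearPMap.sub_domain]

theorem subBounded_apply {A : X →ₗ.[ℂ] X} {B : X →L[ℂ] X} {x : X} (h : x ∈ (subBounded A B).domain)
    (h' : x ∈ A.domain) : subBounded A B ⟨x, h⟩ = A ⟨x, h'⟩ - B x := by
  simp only [subBounded]
  rw [LinearPMap.sub_apply]
  rfl

/-- At the nonzero imaginary points `A` has the resolvent of the diagonal operator whose entries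
are the integers `k`. -/
def HasDiagonalResolvent (Q : ℤ → X →L[ℂ] X) (A : X →ₗ.[ℂ] X) : Prop :=
  ∀ τ : ℝ, τ ≠ 0 → ∃ R : X →L[ℂ] X, IsResolventAt A (τ * Complex.I) R ∧
    ∀ (k : ℤ) x, Q k (R x) = ((k : ℂ) - τ * Complex.I)⁻¹ • Q k x

theorem int_sub_ne_zero (k : ℤ) {τ : ℝ} (hτ : τ ≠ 0) : (k : ℂ) - τ * Complex.I ≠ 0 := fun h => by
  have := congrArg Complex.im h
  simp at this
  exact hτ this

theorem HasDiagonalResolvent.entry_apply {A : X →ₗ.[ℂ] X}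
    (hA : HasDiagonalResolvent Q A) (k : ℤ) (x : A.domain) : Q k (A x) = (k : ℂ) • Q k x := by
  obtain ⟨R, hR, hRQ⟩ := hA 1 one_ne_zero
  have h := hRQ k (A x - ((1 : ℝ) * Complex.I) • (x : X))
  rw [hR.2 x, eq_inv_smul_iff₀ (int_sub_ne_zero k one_ne_zero), map_sub, map_smul, sub_smul] at h
  exact (sub_left_inj.1 h).symm

/-- Comparing entries gives `y = R (w - i y)` for the resolvent `R` at the point `i`, whose values
lie in the domain. -/
theorem IsIntResolution.mem_domain_of_entries (hQ : IsIntResolution Q) {A : X →ₗ.[ℂ] X}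
    (hA : HasDiagonalResolvent Q A) {y w : X} (h : ∀ k : ℤ, Q k w = (k : ℂ) • Q k y) :
    ∃ hy : y ∈ A.domain, A ⟨y, hy⟩ = w := by
  obtain ⟨R, hR, hRQ⟩ := hA 1 one_ne_zero
  have hRy : R (w - ((1 : ℝ) * Complex.I) • y) = y := by
    refine hQ.ext_left fun k => ?_
    rw [hRQ, inv_smul_eq_iff₀ (int_sub_ne_zero k one_ne_zero), map_sub, map_smul, h, sub_smul]
  obtain ⟨hd, hAR⟩ := hR.1 (w - ((1 : ℝ) * Complex.I) • y)
  simp only [hRy] at hd hAR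
  exact ⟨hd, sub_left_inj.1 hAR⟩

/-- For `z = iτ` the entries `τ / (k - iτ)` of `τ R` have modulus at most 1, so `‖τ R‖ ≤ M`. With `τ
= M‖B‖ + 1` a fixed point satisfies `τ‖x‖ ≤ M‖B‖‖x‖`. Consequently `A - B - z` is injective. -/
theorem IsIntResolution.exists_resolvent_comp_fixed_eq_zero [CompleteSpace X] (hQ : IsIntResolution Q)
    {A : X →ₗ.[ℂ] X} (hA : HasDiagonalResolvent Q A) (B : X →L[ℂ] X) :
    ∃ (z : ℂ) (R : X →L[ℂ] X), IsResolventAt A z R ∧ ∀ x, R (B x) = x → x = 0 := by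
  obtain ⟨M, hM0, hM⟩ := hQ.exists_norm_sum_smul_le
  have hτ : 0 < M * ‖B‖ + 1 := by positivity
  set τ : ℝ := M * ‖B‖ + 1 with hτdef
  obtain ⟨R, hR, hRQ⟩ := hA τ hτ.ne'
  refine ⟨_, R, hR, fun x hx => ?_⟩
  have hsum : HasSum (fun k : ℤ => ((τ : ℂ) * ((k : ℂ) - τ * Complex.I)⁻¹) • Q k (B x))
      ((τ : ℂ) • x) := by
    have h1 := (hQ.hasSum (R (B x))).const_smul (τ : ℂ)
    simp only [hRQ, smul_smul] at h1
    rwa [hx] at h1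
  have hnorm := norm_le_of_hasSum_smul hM (fun k => ?_) hsum
  · rw [norm_smul, Complex.norm_real, Real.norm_of_nonneg hτ.le] at hnorm
    have h2 := hnorm.trans (mul_le_mul_of_nonneg_left (B.le_opNorm x) hM0)
    rw [hτdef] at h2
    exact norm_le_zero_iff.1 (by linarith)
  · rw [norm_mul, norm_inv, ← div_eq_mul_inv]
    refine div_le_one_of_le₀ ?_ (norm_nonneg _)
    rw [Complex.norm_real]
    have h3 := Complex.abs_im_le_norm ((k : ℂ) - τ * Complex.I)
    simpa using h3

theorem IsIntResolution.areSimilar_of_intertwiner [CompleteSpace X] (hQ : IsIntResolution Q)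
    {A : X →ₗ.[ℂ] X} (hA : HasDiagonalResolvent Q A) {B : X →L[ℂ] X} (W : (X →L[ℂ] X)ˣ)
    (hW : ∀ (i j : ℤ) x,
      ((i - j : ℤ) : ℂ) • Q i (W.val (Q j x)) = Q i (B (W.val (Q j x)))) :
    AreSimilar (subBounded A B) A := by
  have hdom : ∀ x : A.domain, ∃ h : W.val (x : X) ∈ A.domain,
      A ⟨W.val (x : X), h⟩ = B (W.val (x : X)) + W.val (A x) := fun x => by
    refine hQ.mem_domain_of_entries hA fun k => ?_
    have h1 := ((hQ.hasSum (x : X)).mapL ((Q k).comp W.val)).const_smul (k : ℂ)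
    have h2 := ((hQ.hasSum (x : X)).mapL ((Q k).comp (B.comp W.val))).add
      ((hQ.hasSum (A x)).mapL ((Q k).comp W.val))
    rw [map_add]
    refine h1.unique ?_ |>.symm
    convert h2 using 2 with j
    rotate_left
    · rfl
    · rfl
    simp only [ContinuousLinearMap.comp_apply]
    rw [← hW, HasDiagonalResolvent.entry_apply hA, map_smul, map_smul, ← add_smul]
    congr 1
    push_cast
    ring
  have hWW : ∀ y, W.val (W⁻¹.val y) = y := fun y => by
    rw [← mul_apply_eq_comp, W.mul_inv, one_apply_eq_self]
  refine ⟨ContinuousLinearEquiv.unitsEquiv ℂ X W, ?_, fun x h => ?_⟩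
  · apply Set.Subset.antisymm
    · rintro _ ⟨x, hx, rfl⟩
      exact mem_domain_subBounded.2 (hdom ⟨x, hx⟩).1
    · intro x hx
      have hx' : x ∈ A.domain := mem_domain_subBounded.1 hx
      obtain ⟨z, R, hR, hRB⟩ := hQ.exists_resolvent_comp_fixed_eq_zero hA B
      obtain ⟨hu, hAu⟩ := hR.1 (W⁻¹.val (A ⟨x, hx'⟩ - B x - z • x))
      -- This `u` solves `W (A - z) u = (A - B - z) x`. Intertwining turns the left side into `(A -
      -- B - z) W u`, so `W u - x` is fixed by `R B` and vanishes.
      set u := R (W⁻¹.val (A ⟨x, hx'⟩ - B x - z • x))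
      refine ⟨u, hu, ?_⟩
      obtain ⟨hWu, hAWu⟩ := hdom ⟨u, hu⟩
      rw [← sub_eq_zero]
      refine hRB (W.val u - x) ?_
      have h1 := hR.2 (⟨W.val u, hWu⟩ - ⟨x, hx'⟩)
      rw [LinearPMap.map_sub, hAWu, sub_eq_iff_eq_add.1 hAu, map_add, hWW, map_smul] at h1
      convert h1 using 2
      · rw [Submodule.coe_sub, map_sub, smul_sub]
        abel
      · rfl
  · obtain ⟨hWx, hAWx⟩ := hdom x
    have := subBounded_apply h hWx
    rw [this]
    change A ⟨W.val (x : X), hWx⟩ - B (W.val (x : X)) = W.val (A x)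
    rw [hAWx, add_sub_cancel_left]

/-! ### Passage from `J` to `ℤ`, and the resolvents of the generator. -/

section Extension

variable {J : Set ℤ} {P : J → X →L[ℂ] X}

open Classical in
/-- The extension by zero of a family of projections to all the integers. -/
def extendZero (P : J → X →L[ℂ] X) (k : ℤ) : X →L[ℂ] X := if h : k ∈ J then P ⟨k, h⟩ else 0

theorem extendZero_coe (P : J → X →L[ℂ] X) (k : J) : extendZero P k = P k := dif_pos k.2

theorem extendZero_of_notMem (P : J → X →L[ℂ] X) {k : ℤ} (h : k ∉ J) : extendZero P k = 0 :=
  dif_neg h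

theorem hasSum_smul_extendZero {c : ℤ → ℂ} {x y : X} :
    HasSum (fun k => c k • extendZero P k x) y ↔ HasSum (fun k : J => c k • P k x) y := by
  rw [← Subtype.val_injective.hasSum_iff (f := fun k => c k • extendZero P k x) fun k hk => by
    rw [extendZero_of_notMem P fun h => hk ⟨⟨k, h⟩, rfl⟩]; simp]
  simp only [Function.comp_def, extendZero_coe]

theorem IsResolutionOfIdentity.isIntResolution (hP : IsResolutionOfIdentity P) :
    IsIntResolution (extendZero P) where
  apply_self k x := by
    by_cases h : k ∈ J
    · rw [extendZero_coe P ⟨k, h⟩, ← ContinuousLinearMap.comp_apply, hP.idempotent]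
    · simp [extendZero_of_notMem P h]
  apply_ne i j hij x := by
    by_cases hi : i ∈ J
    · by_cases hj : j ∈ J
      · rw [extendZero_coe P ⟨i, hi⟩, extendZero_coe P ⟨j, hj⟩, ← ContinuousLinearMap.comp_apply,
          hP.disjoint _ _ fun h => hij (congrArg Subtype.val h), zero_apply]
      · simp [extendZero_of_notMem P hj]
    · simp [extendZero_of_notMem P hi]
  hasSum x := by
    have := (hasSum_smul_extendZero (P := P) (c := 1) (x := x) (y := x)).2
    simp only [Pi.one_apply, one_smul] at this
    exact this (hP.hasSum x)

theorem isRotation_rep [CompleteSpace X] (hP : IsResolutionOfIdentity P) :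
    IsRotation (extendZero P) (rep hP) := fun t x => by
  rw [hasSum_smul_extendZero (c := fun k : ℤ => Complex.exp (Complex.I * k * t)), rep_apply]
  exact hasSum_rep hP t x

/-- Under `Q k` the operator `T (-t)` becomes the scalar `exp (-ikt)`, so the integral defining the
resolvent becomes the Fourier transform of `f` at `k`. -/
theorem IsModuleGenerator.hasDiagonalResolvent [CompleteSpace X] {T : ℝ → X →L[ℂ] X}
    {A : X →ₗ.[ℂ] X} (hA : IsModuleGenerator T A) (hQ : IsIntResolution Q) (hT : IsRotation Q T) :
    HasDiagonalResolvent Q A := by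
  intro τ hτ
  obtain ⟨R, f, hR, hf, hfT, hRf⟩ := hA.2 (τ * Complex.I) (by simpa using hτ)
  refine ⟨R, hR, fun k x => ?_⟩
  obtain ⟨M, hM0, hM⟩ := hQ.exists_norm_sum_smul_le
  have hc : Continuous fun t => T (-t) x :=
    (hT.continuous_uncurry hQ).comp (f := fun t => (x, -t)) (by fun_prop)
  have hint : Integrable fun t => f t • T (-t) x := by
    refine (hf.norm.mul_const (M * ‖x‖)).mono' (hf.1.smul hc.aestronglyMeasurable)
      (ae_of_all _ fun t => ?_)
    rw [norm_smul]
    exact mul_le_mul_of_nonneg_left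
      (norm_le_of_hasSum_smul hM (fun k => (norm_exp_I_mul k _).le) (hT (-t) x)) (norm_nonneg _)
  rw [hRf, moduleAction, ← ContinuousLinearMap.integral_comp_comm _ hint]
  simp only [map_smul, hQ.comp_diag (hT _), smul_smul]
  rw [integral_smul_const]
  congr 1
  have := hfT k
  simp only [Complex.ofReal_intCast, Complex.ofReal_neg, mul_neg] at this ⊢
  exact this

theorem entry_extendZero_eq_zero {B : X →L[ℂ] X} {p : ℤ → ℤ → Prop}
    (h : ∀ i j : J, p i j → operatorMatrix P B i j = 0) (i j : ℤ) (x : X) (hij : p i j) :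
    extendZero P i (B (extendZero P j x)) = 0 := by
  by_cases hi : i ∈ J
  · by_cases hj : j ∈ J
    · rw [extendZero_coe P ⟨i, hi⟩, extendZero_coe P ⟨j, hj⟩]
      exact DFunLike.congr_fun (h ⟨i, hi⟩ ⟨j, hj⟩ hij) x
    · simp [extendZero_of_notMem P hj]
  · simp [extendZero_of_notMem P hi]

end Extension

end SimilarOperators

end

theorem mainTheorem12 {X : Type*} [NormedAddCommGroup X] [NormedSpace ℂ X] [CompleteSpace X]
    (J : Set ℤ) (hJ : J = {k | 1 ≤ k} ∨ J = Set.univ)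
    (P : J → X →L[ℂ] X) (hP : SimilarOperators.IsResolutionOfIdentity P)
    (A : X →ₗ.[ℂ] X) (hA : SimilarOperators.IsModuleGenerator (SimilarOperators.rep hP) A)
    (B : X →L[ℂ] X)
    (hB : SimilarOperators.IsStrictlyUpperTriangular (SimilarOperators.operatorMatrix P B) ∨
      SimilarOperators.IsStrictlyLowerTriangular (SimilarOperators.operatorMatrix P B)) :
    SimilarOperators.AreSimilar (SimilarOperators.subBounded A B) A := by
  have hQ := hP.isIntResolution
  have hAQ := hA.hasDiagonalResolvent hQ (SimilarOperators.isRotation_rep hP)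
  rcases hB with hB | hB
  · have hB' := SimilarOperators.entry_extendZero_eq_zero (B := B) (p := fun i j => j ≤ i) hB
    -- The intertwiner carries the factor `j - i`, while similarity needs `i - j`; replacing `B` by
    -- `-B` corrects the sign.
    obtain ⟨W, hW⟩ := hQ.exists_intertwiner (B := -B) fun i j x hij => by
      rw [neg_apply, map_neg, hB' i j x hij, neg_zero]
    refine hQ.areSimilar_of_intertwiner hAQ W fun i j x => ?_
    have h := hW i j x
    rw [neg_apply, map_neg] at h
    rw [← neg_sub, Int.cast_neg, neg_smul, h, neg_neg]
  · have hB' := SimilarOperators.entry_extendZero_eq_zero (B := B) (p := fun i j => i ≤ j) hB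
    -- Here the reflection of the indices itself supplies the sign, so `B` is kept.
    obtain ⟨W, hW⟩ := hQ.comp_neg.exists_intertwiner (B := B) fun i j x hij =>
      hB' _ _ x (neg_le_neg hij)
    refine hQ.areSimilar_of_intertwiner hAQ W fun i j x => ?_
    have h := hW (-i) (-j) x
    simp only [neg_neg] at h
    rw [← h]
    congr 2
    ring
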